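/- Let $K$ be any field and let $Q$ be a finite connected quiver (finitely many vertices, at least one; finitely many arrows, loops and parallel arrows allowed). All representations are over $K$ and finite-dimensional. For a representation $\phi$ of $Q$, let $\mathrm{surj}(\phi)\subseteq\phi$ be the largest subrepresentation in which every arrow acts by an epimorphism, let $\phi\twoheadrightarrow\mathrm{inj}(\phi)$ be the largest quotient in which every arrow acts by a monomorphism, and let $\mathrm{rk}(\phi)$ be the image of the composition $\mathrm{surj}(\phi)\hookrightarrow\phi\twoheadrightarrow\mathrm{inj}(\phi)$. Every arrow acts on $\mathrm{rk}(\phi)$ by an isomorphism, so, $Q$ being connected, its vector spaces have a common dimension: the global rank $\mathrm{rank}_Q(\phi)$. For a morphism of quivers $f\colon Q'\to Q''$ there are the pullback $f^*\psi=(\psi_{f(x)},\psi_{f(a)})$ and the pushforward $f_*\phi=\bigl(\bigoplus_{y\in f^{-1}(x)}\phi_y,\ \sum_{b\in f^{-1}(a)}\phi_b\bigr)$, where each $\phi_b$ is extended by zero. A rank function on $Q$ is a function of $\phi$ obtained by applying successively to $\phi$ finitely many (possibly no) pushforwards and pullbacks along a chain of morphisms $Q=Q_1 - Q_2 - \cdots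 - Q_m$ of finite connected quivers (each morphism in either direction) and then taking the global rank on $Q_m$. For a dimension vector $\alpha$ let $\mathrm{rep}(Q,\alpha)=\bigoplus_{a}\mathrm{Hom}_K(K^{\alpha(ta)},K^{\alpha(ha)})$ (sum over the arrows $a$ of $Q$, with tail $ta$ and head $ha$), with the Zariski topology, whose closed sets are the zero loci of polynomials over $K$ in the matrix entries. A subset is constructible if it is obtained from finitely many open or closed subsets by unions and intersections. A rank locus in $\mathrm{rep}(Q,\alpha)$ is the set of points at which the values of finitely many rank functions on $Q$ satisfy a finite list of linear inequalities (weak or strict, with real coefficients). **Theorem.** For every dimension vector $\alpha$ of $Q$ and every nonnegative integer $n$, the set $\{\phi\in\mathrm{rep}(Q,\alpha) : \mathrm{rank}_Q(\phi)=n\}$ is constructible in $\mathrm{rep}(Q,\alpha)$. Moreover, every rank locus in $\mathrm{rep}(Q,\alpha)$ is constructible. -/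

import Mathlib

universe u v k w

/-- A finite quiver: finitely many vertices and finitely many arrows (loops and parallel arrows
are allowed). -/
class IsFiniteQuiver (V : Type u) [Quiver.{v} V] : Prop where
  finite_vertices : Finite V
  finite_arrows : ∀ x y : V, Finite (x ⟶ y)

attribute [instance] IsFiniteQuiver.finite_vertices IsFiniteQuiver.finite_arrows

/-- A connected quiver: it has a vertex, and any two vertices are joined by a walk that may
traverse arrows forwards and backwards. -/
class IsConnectedQuiver (V : Type u) [Quiver.{v} V] : Prop where
  nonempty : Nonempty V
  connected : Quiver.IsStronglyConnected (Quiver.Symmetrify V)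

/-- A representation of a quiver over `K`: a finite-dimensional vector space at each vertex and
a linear map for each arrow. -/
structure QuiverRep (K : Type k) [Field K] (V : Type u) [Quiver.{v} V] where
  space : V → Type w
  [addCommGroup : ∀ x, AddCommGroup (space x)]
  [module : ∀ x, Module K (space x)]
  [finiteDimensional : ∀ x, FiniteDimensional K (space x)]
  map : ∀ {x y : V}, (x ⟶ y) → (space x →ₗ[K] space y)

attribute [instance] QuiverRep.addCommGroup QuiverRep.module QuiverRep.finiteDimensional

namespace QuiverRep

section Rank

variable {K : Type k} [Field K] {V : Type u} [Quiver.{v} V]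

/-- Every arrow acts by an epimorphism. -/
def IsEpimorphic (φ : QuiverRep.{u, v, k, w} K V) : Prop :=
  ∀ (x y : V) (a : x ⟶ y), Function.Surjective (φ.map a)

/-- Every arrow acts by a monomorphism. -/
def IsMonomorphic (φ : QuiverRep.{u, v, k, w} K V) : Prop :=
  ∀ (x y : V) (a : x ⟶ y), Function.Injective (φ.map a)

/-- A subrepresentation: subspaces at the vertices that are stable under all arrows. -/
structure SubRep (φ : QuiverRep.{u, v, k, w} K V) where
  carrier : ∀ x, Submodule K (φ.space x)
  stable : ∀ {x y : V} (a : x ⟶ y), carrier x ≤ (carrier y).comap (φ.map a)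

namespace SubRep

variable {φ : QuiverRep.{u, v, k, w} K V}

/-- A subrepresentation, as a representation. -/
def toRep (W : SubRep φ) : QuiverRep.{u, v, k, w} K V where
  space x := W.carrier x
  map a := (φ.map a).restrict (W.stable a)

/-- The quotient of a representation by a subrepresentation. -/
def quotient (W : SubRep φ) : QuiverRep.{u, v, k, w} K V where
  space x := φ.space x ⧸ W.carrier x
  map {x y} a := (W.carrier x).mapQ (W.carrier y) (φ.map a) (W.stable a)

end SubRep

/-- The sum of all epimorphic subrepresentations. By `surjRep_isEpimorphic` and
`le_surjRep` it is the unique largest epimorphic subrepresentation. -/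
def surjRep (φ : QuiverRep.{u, v, k, w} K V) : SubRep φ where
  carrier x := ⨆ W : {W : SubRep φ // W.toRep.IsEpimorphic}, W.1.carrier x
  stable {_ y} a := iSup_le fun W _ hv =>
    Submodule.mem_iSup_of_mem (p := fun W : {W : SubRep φ // W.toRep.IsEpimorphic} =>
      W.1.carrier y) W (W.1.stable a hv)

/-- The intersection of all subrepresentations whose quotient is monomorphic. By
`injKer_isMonomorphic` and `injKer_le` the quotient by it is the unique largest monomorphic
quotient of `φ`. -/
def injKer (φ : QuiverRep.{u, v, k, w} K V) : SubRep φ where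
  carrier x := ⨅ N : {N : SubRep φ // N.quotient.IsMonomorphic}, N.1.carrier x
  stable {x y} a v hv := by
    rw [Submodule.mem_comap, Submodule.mem_iInf]
    intro N
    exact N.1.stable a ((Submodule.mem_iInf _).1 hv N)

theorem le_surjRep (φ : QuiverRep.{u, v, k, w} K V) (W : SubRep φ) (hW : W.toRep.IsEpimorphic)
    (x : V) : W.carrier x ≤ φ.surjRep.carrier x :=
  le_iSup (fun W : {W : SubRep φ // W.toRep.IsEpimorphic} => W.1.carrier x) ⟨W, hW⟩

theorem injKer_le (φ : QuiverRep.{u, v, k, w} K V) (N : SubRep φ) (hN : N.quotient.IsMonomorphic)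
    (x : V) : φ.injKer.carrier x ≤ N.carrier x :=
  iInf_le (fun N : {N : SubRep φ // N.quotient.IsMonomorphic} => N.1.carrier x) ⟨N, hN⟩

theorem surjRep_isEpimorphic (φ : QuiverRep.{u, v, k, w} K V) :
    φ.surjRep.toRep.IsEpimorphic := by
  intro x y a
  have key : φ.surjRep.carrier y ≤ (φ.surjRep.carrier x).map (φ.map a) := by
    refine iSup_le fun W z hz => ?_
    obtain ⟨t, ht⟩ := W.2 x y a ⟨z, hz⟩
    exact ⟨t.1, φ.le_surjRep W.1 W.2 x t.2, congrArg Subtype.val ht⟩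
  rintro ⟨z, hz⟩
  obtain ⟨t, ht, h⟩ := key hz
  exact ⟨⟨t, ht⟩, Subtype.ext h⟩

theorem injKer_isMonomorphic (φ : QuiverRep.{u, v, k, w} K V) :
    φ.injKer.quotient.IsMonomorphic := by
  intro x y a
  refine (injective_iff_map_eq_zero (φ.injKer.quotient.map a)).2 fun z => ?_
  obtain ⟨t, rfl⟩ := Submodule.Quotient.mk_surjective _ z
  intro h
  have h1 : φ.map a t ∈ φ.injKer.carrier y := (Submodule.Quotient.mk_eq_zero _).1 h
  refine (Submodule.Quotient.mk_eq_zero _).2 ((Submodule.mem_iInf _).2 fun N => ?_)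
  refine (Submodule.Quotient.mk_eq_zero _).1 (N.2 x y a (a₂ := 0) ?_)
  rw [map_zero]
  exact (Submodule.Quotient.mk_eq_zero _).2 (φ.injKer_le N.1 N.2 y h1)

/-- The image of the composition `surjRep φ ↪ φ ↠ φ / injKer φ`, as a subrepresentation of the
largest monomorphic quotient. -/
def rk (φ : QuiverRep.{u, v, k, w} K V) : SubRep φ.injKer.quotient where
  carrier x := LinearMap.range ((φ.injKer.carrier x).mkQ ∘ₗ (φ.surjRep.carrier x).subtype)
  stable {x y} a := by
    rintro _ ⟨t, rfl⟩
    exact ⟨⟨φ.map a t.1, φ.surjRep.stable a t.2⟩, rfl⟩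

theorem finrank_rk_eq_of_arrow (φ : QuiverRep.{u, v, k, w} K V) {x y : V} (a : x ⟶ y) :
    Module.finrank K (φ.rk.carrier x) = Module.finrank K (φ.rk.carrier y) := by
  refine LinearEquiv.finrank_eq (LinearEquiv.ofBijective (φ.rk.toRep.map a) ⟨?_, ?_⟩)
  · intro s t h
    exact Subtype.ext (φ.injKer_isMonomorphic x y a (congrArg Subtype.val h))
  · rintro ⟨_, ⟨t, rfl⟩⟩
    obtain ⟨s, rfl⟩ := φ.surjRep_isEpimorphic x y a t
    exact ⟨⟨_, ⟨s, rfl⟩⟩, rfl⟩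

/-- On a connected quiver the spaces of `rk φ` have a common dimension. -/
theorem finrank_rk_eq [IsConnectedQuiver V] (φ : QuiverRep.{u, v, k, w} K V) (x y : V) :
    Module.finrank K (φ.rk.carrier x) = Module.finrank K (φ.rk.carrier y) := by
  obtain ⟨p⟩ := IsConnectedQuiver.connected (V := V) x y
  induction p with
  | nil => rfl
  | cons p a ih =>
    rcases a with a | a
    · exact ih.trans (φ.finrank_rk_eq_of_arrow a)
    · exact ih.trans (φ.finrank_rk_eq_of_arrow a).symm

/-- The global rank of a representation of a connected quiver: the common dimension of the
spaces of `rk φ` (see `finrank_rk_eq`; the choice of the vertex is irrelevant). -/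
noncomputable def globalRank [IsConnectedQuiver V] (φ : QuiverRep.{u, v, k, w} K V) : ℕ :=
  Module.finrank K (φ.rk.carrier (Classical.choice (IsConnectedQuiver.nonempty (V := V))))

end Rank

section Functors

variable {K : Type k} [Field K] {V W : Type u} [Quiver.{v} V] [Quiver.{v} W]

/-- The pullback `f^* ψ = (ψ_{f(x)}, ψ_{f(a)})`. -/
def pullback (f : V ⥤q W) (ψ : QuiverRep.{u, v, k, w} K W) : QuiverRep.{u, v, k, w} K V where
  space x := ψ.space (f.obj x)
  map a := ψ.map (f.map a)

/-- The pushforward `f_* φ`. Its space at a vertex `x` is the direct sum of the spaces of `φ` over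
the fibre `f⁻¹(x)`; an arrow `a : x ⟶ x'` acts by the sum of the maps of `φ` over all arrows `b`
in the fibre `f⁻¹(a)`, each extended by zero. The component of this map with target the summand
of `z' ∈ f⁻¹(x')` is written out. (All sums are finite for finite quivers.) -/
noncomputable def pushforward [IsFiniteQuiver V] (f : V ⥤q W) (φ : QuiverRep.{u, v, k, w} K V) :
    QuiverRep.{u, v, k, max u w} K W where
  space x := ∀ z : {z : V // f.obj z = x}, φ.space z.1
  map {x x'} a := LinearMap.pi fun z' : {z : V // f.obj z = x'} =>
    ∑ᶠ z : {z : V // f.obj z = x},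
      ∑ᶠ b : {b : z.1 ⟶ z'.1 // Quiver.homOfEq (f.map b) z.2 z'.2 = a},
        φ.map b.1 ∘ₗ LinearMap.proj z

end Functors

end QuiverRep

/-- A chain of morphisms `V → Q₂ ← Q₃ → ⋯` of finite connected quivers, in arbitrary directions,
that starts at the finite connected quiver `V`. -/
inductive RankChain : (V : Type u) → [Quiver.{v} V] → Type (max (u + 1) (v + 1))
  | nil {V : Type u} [Quiver.{v} V] [IsFiniteQuiver V] [IsConnectedQuiver V] : RankChain V
  | push {V W : Type u} [Quiver.{v} V] [Quiver.{v} W] [IsFiniteQuiver V] [IsConnectedQuiver V]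
      (f : V ⥤q W) (c : RankChain W) : RankChain V
  | pull {V W : Type u} [Quiver.{v} V] [Quiver.{v} W] [IsFiniteQuiver V] [IsConnectedQuiver V]
      (f : W ⥤q V) (c : RankChain W) : RankChain V

/-- The rank function of a chain: push forward or pull back along its morphisms one after the
other, then take the global rank on the last quiver. -/
noncomputable def RankChain.rank {K : Type k} [Field K] {V : Type u} [Quiver.{v} V] :
    RankChain.{u, v} V → QuiverRep.{u, v, k, max u w} K V → ℕ
  | @RankChain.nil _ _ _ _, φ => φ.globalRank
  | @RankChain.push _ _ _ _ _ _ f c, φ =>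
    c.rank (QuiverRep.pushforward.{u, v, k, max u w} f φ)
  | @RankChain.pull _ _ _ _ _ _ f c, φ => c.rank (φ.pullback f)

section RepSpace

variable (K : Type k) [Field K] {V : Type u} [Quiver.{v} V]

/-- The representation space `rep(Q, α) = ⨁_a Hom(K^{α(ta)}, K^{α(ha)})`. -/
def RepSpace (α : V → ℕ) : Type (max u v k) :=
  ∀ (x y : V) (_ : x ⟶ y), (Fin (α x) → K) →ₗ[K] (Fin (α y) → K)

/-- The indices of the affine coordinates on `rep(Q, α)`: an arrow and a matrix position. -/
abbrev RepCoord (α : V → ℕ) : Type (max u v) :=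
  Σ (x : V) (y : V) (_ : x ⟶ y), Fin (α y) × Fin (α x)

variable {K} {α : V → ℕ}

/-- The affine coordinates (all matrix entries) of a point of `rep(Q, α)`. -/
def RepSpace.coord (φ : RepSpace K α) : RepCoord α → K
  | ⟨x, y, a, i, j⟩ => φ x y a (Pi.single j 1) i

/-- The Zariski topology on `rep(Q, α)`: the closed sets are the zero loci of sets of polynomials
with coefficients in `K` in the matrix entries. -/
instance RepSpace.zariski : TopologicalSpace (RepSpace K α) :=
  TopologicalSpace.ofClosed
    {Z | ∃ S : Set (MvPolynomial (RepCoord α) K),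
      Z = {φ | ∀ p ∈ S, MvPolynomial.eval φ.coord p = 0}}
    ⟨{1}, by ext φ; simp⟩
    (by
      intro A hA
      choose S hS using fun Z : A => hA Z.2
      refine ⟨⋃ Z : A, S Z, Set.ext fun φ => ?_⟩
      simp only [Set.mem_sInter, Set.mem_iUnion, Set.mem_ofPred_eq]
      constructor
      · rintro h p ⟨Z, hp⟩
        have := h Z.1 Z.2
        rw [hS Z] at this
        exact this p hp
      · intro h Z hZ
        exact (Set.ext_iff.1 (hS ⟨Z, hZ⟩) φ).2 fun p hp => h p ⟨⟨Z, hZ⟩, hp⟩)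
    (by
      rintro _ ⟨S, rfl⟩ _ ⟨T, rfl⟩
      refine ⟨Set.image2 (fun p q => p * q) S T, Set.ext fun φ => ?_⟩
      constructor
      · rintro (h | h) _ ⟨p, hp, q, hq, rfl⟩
        · simp [h p hp]
        · simp [h q hq]
      · intro h
        by_contra hn
        simp only [Set.mem_union, Set.mem_ofPred_eq, not_or, not_forall] at hn
        obtain ⟨⟨p, hp, h1⟩, q, hq, h2⟩ := hn
        have := h _ ⟨p, hp, q, hq, rfl⟩
        rw [map_mul] at this
        exact (mul_ne_zero h1 h2) this)

/-- A point of `rep(Q, α)` as a representation with the space `K^{α(x)}` at each vertex `x` (lifted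
to a larger universe, so that it can be pushed forward). -/
def RepSpace.toRep (φ : RepSpace K α) : QuiverRep.{u, v, k, max u k} K V where
  space x := ULift.{u} (Fin (α x) → K)
  map {x y} a :=
    ULift.moduleEquiv.symm.toLinearMap ∘ₗ φ x y a ∘ₗ ULift.moduleEquiv.toLinearMap

/-- A rank locus in `rep(Q, α)`: the set of points at which the values of some rank functions
`c₁, …, c_m` satisfy a finite list of linear inequalities, weak or strict. -/
def IsRankLocus (L : Set (RepSpace K α)) : Prop :=
  ∃ (m l : ℕ) (c : Fin m → RankChain.{u, v} V) (A : Matrix (Fin l) (Fin m) ℝ) (b : Fin l → ℝ)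
    (strict : Set (Fin l)),
    L = {φ | ∀ j : Fin l,
      ∑ i, A j i * (RankChain.rank.{u, v, k, k} (c i) φ.toRep : ℝ) ≤ b j ∧
      (j ∈ strict → ∑ i, A j i * (RankChain.rank.{u, v, k, k} (c i) φ.toRep : ℝ) < b j)}

end RepSpace

/-! The space of `rk φ` at a vertex has dimension `dim surj - dim (surj ∩ injKer)`. Both `surj` and
`injKer` are reached by iterating sums, intersections, images and preimages along arrows, and the
number of iterations is bounded by the total dimension of `φ`, hence uniformly over `rep(Q, α)`. It
therefore suffices to do linear algebra uniformly in the point, up to finitely many constructible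
pieces.

The case distinctions of Gaussian elimination are absorbed into a ring `R`: the functions that are,
piecewise on constructible sets, quotients of polynomial functions. Since `R` is closed under
pointwise inversion with `0⁻¹ = 0`, it is von Neumann regular, so every matrix `M` over it has some
`G` with `M * G * M = M` (`Matrix.exists_mul_mul_eq_self`). At every point this gives `ker M = range
(1 - G * M)` and `range M = ker (1 - M * G)`. Hence families of subspaces cut out over `R` are
closed under all the operations above, and their dimensions are piecewise constant
(`IsDefinableSubspace.isPiecewiseConstant_finrank`).

Families of representations with matrices over `R` are preserved by pullback and pushforward, so
every rank function is piecewise constant. Any condition on finitely many such functions defines a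
constructible set. -/

open Topology

/-! ### Matrices over von Neumann regular rings -/

section VonNeumannRegular

variable {R : Type*} [CommRing R] {m n : Type*} [Fintype m] [Fintype n]

/-- `N` arises from `M` by subtracting `M * X * M` for some `X`. -/
def Matrix.InnerReduces (M N : Matrix m n R) : Prop :=
  ∃ X : Matrix n m R, N = M - M * X * M

theorem Matrix.InnerReduces.refl (M : Matrix m n R) : M.InnerReduces M :=
  ⟨0, by simp⟩

theorem Matrix.InnerReduces.trans {M N L : Matrix m n R} (h : M.InnerReduces N)
    (h' : N.InnerReduces L) : M.InnerReduces L := by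
  classical
  obtain ⟨X, rfl⟩ := h
  obtain ⟨Y, rfl⟩ := h'
  -- With `N = M - M * X * M`, one has `N = M * (1 - X * M) = (1 - M * X) * M`; substitute these for
  -- the two factors of `N * Y * N`.
  refine ⟨X + (1 - X * M) * Y * (1 - M * X), ?_⟩
  simp only [Matrix.mul_add, Matrix.add_mul, Matrix.mul_sub, Matrix.sub_mul, Matrix.mul_one,
    Matrix.one_mul, Matrix.mul_assoc]
  abel

/-- Row `i` of `M * X * M` is row `i` of `M` times `X * M`, so rows already cleared survive later
reductions. -/
theorem Matrix.InnerReduces.row_eq_zero {M N : Matrix m n R} (h : M.InnerReduces N) {i : m}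
    (hi : M i = 0) : N i = 0 := by
  obtain ⟨X, rfl⟩ := h
  ext j
  have : ∀ j, M i j = 0 := fun j => congrFun hi j
  simp [Matrix.mul_assoc, Matrix.mul_apply, this]

/-- A reduction by the one-entry matrix with `b` at `(j, i)` multiplies row `i` by `1 - N i j * b`.
This kills entry `j` when `b` is an inner inverse of `N i j`, and keeps the zeros of that row. -/
theorem Matrix.exists_innerReduces_row (hR : ∀ a : R, ∃ b, a * b * a = a) (M : Matrix m n R)
    (i : m) : ∃ N, M.InnerReduces N ∧ N i = 0 := by
  classical
  suffices H : ∀ s : Finset n, ∃ N, M.InnerReduces N ∧ ∀ j ∈ s, N i j = 0 by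
    obtain ⟨N, h, h0⟩ := H Finset.univ
    exact ⟨N, h, funext fun j => h0 j (Finset.mem_univ j)⟩
  intro s
  induction s using Finset.induction_on with
  | empty => exact ⟨M, .refl M, by simp⟩
  | insert j s _ ih =>
    obtain ⟨N, h, h0⟩ := ih
    obtain ⟨b, hb⟩ := hR (N i j)
    have key : ∀ l, (N - N * Matrix.single j i b * N) i l = N i l - N i j * b * N i l := by
      intro l
      rw [Matrix.sub_apply, Matrix.mul_assoc, Matrix.mul_apply, Finset.sum_eq_single j]
      · simp [mul_assoc]
      · intro k _ hk
        rw [Matrix.single_mul_apply_of_ne _ _ _ _ _ hk, mul_zero]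
      · simp
    refine ⟨_, h.trans ⟨Matrix.single j i b, rfl⟩, fun l hl => ?_⟩
    rw [key]
    rcases Finset.mem_insert.1 hl with rfl | hl
    · rw [hb, sub_self]
    · rw [h0 l hl, mul_zero, sub_zero]

/-- Matrices over a commutative von Neumann regular ring have inner inverses. -/
theorem Matrix.exists_mul_mul_eq_self (hR : ∀ a : R, ∃ b, a * b * a = a) (M : Matrix m n R) :
    ∃ G : Matrix n m R, M * G * M = M := by
  classical
  -- Once `M` reduces to zero, the equation `0 = M - M * G * M` is the claim.
  suffices H : ∀ s : Finset m, ∃ N, M.InnerReduces N ∧ ∀ i ∈ s, N i = 0 by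
    obtain ⟨N, ⟨G, hG⟩, h0⟩ := H Finset.univ
    have : N = 0 := funext fun i => h0 i (Finset.mem_univ i)
    exact ⟨G, (sub_eq_zero.1 (hG.symm.trans this)).symm⟩
  intro s
  induction s using Finset.induction_on with
  | empty => exact ⟨M, .refl M, by simp⟩
  | insert i s _ ih =>
    obtain ⟨N, h, h0⟩ := ih
    obtain ⟨L, h', hL⟩ := N.exists_innerReduces_row hR i
    refine ⟨L, h.trans h', fun k hk => ?_⟩
    rcases Finset.mem_insert.1 hk with rfl | hk
    · exact hL
    · exact h'.row_eq_zero (h0 k hk)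

end VonNeumannRegular

/-! ### Properties that hold piecewise on constructible sets -/

section Piecewise

variable {X : Type*} [TopologicalSpace X]

/-- `X` is a finite union of constructible sets with the property `P`. -/
def PiecewiseConstructible (P : Set X → Prop) : Prop :=
  ∃ 𝒮 : Set (Set X), 𝒮.Finite ∧ (∀ S ∈ 𝒮, IsConstructible S ∧ P S) ∧ ⋃₀ 𝒮 = Set.univ

theorem PiecewiseConstructible.of_univ {P : Set X → Prop} (h : P Set.univ) :
    PiecewiseConstructible P :=
  ⟨{Set.univ}, Set.finite_singleton _, fun S hS => by
    rw [Set.mem_singleton_iff.1 hS]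
    exact ⟨IsConstructible.univ, h⟩, by simp⟩

theorem PiecewiseConstructible.mono {P Q : Set X → Prop} (hP : PiecewiseConstructible P)
    (h : ∀ S, P S → Q S) : PiecewiseConstructible Q := by
  obtain ⟨𝒮, hf, hS, hU⟩ := hP
  exact ⟨𝒮, hf, fun S hS' => ⟨(hS S hS').1, h S (hS S hS').2⟩, hU⟩

theorem PiecewiseConstructible.inter {P Q R : Set X → Prop} (hP : PiecewiseConstructible P)
    (hQ : PiecewiseConstructible Q) (h : ∀ S T, P S → Q T → R (S ∩ T)) :
    PiecewiseConstructible R := by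
  obtain ⟨𝒮, hf, hS, hU⟩ := hP
  obtain ⟨𝒯, hf', hT, hU'⟩ := hQ
  refine ⟨Set.image2 (· ∩ ·) 𝒮 𝒯, hf.image2 _ hf', ?_, ?_⟩
  · rintro _ ⟨S, hS', T, hT', rfl⟩
    exact ⟨(hS S hS').1.inter (hT T hT').1, h S T (hS S hS').2 (hT T hT').2⟩
  · refine Set.eq_univ_of_forall fun x => ?_
    obtain ⟨S, hS', hx⟩ := hU.symm ▸ Set.mem_univ x
    obtain ⟨T, hT', hx'⟩ := hU'.symm ▸ Set.mem_univ x
    exact ⟨_, ⟨S, hS', T, hT', rfl⟩, hx, hx'⟩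

/-- A function on `X` that is constant on each of finitely many constructible sets covering `X`. -/
def IsPiecewiseConstant {T : Type*} (r : X → T) : Prop :=
  PiecewiseConstructible fun S => ∀ x ∈ S, ∀ y ∈ S, r x = r y

theorem IsPiecewiseConstant.prodMk {T T' : Type*} {r : X → T} {r' : X → T'}
    (h : IsPiecewiseConstant r) (h' : IsPiecewiseConstant r') :
    IsPiecewiseConstant fun x => (r x, r' x) :=
  PiecewiseConstructible.inter h h' fun _ _ hS hT x hx y hy =>
    Prod.ext (hS x hx.1 y hy.1) (hT x hx.2 y hy.2)

theorem IsPiecewiseConstant.comp {T T' : Type*} {r : X → T} (h : IsPiecewiseConstant r)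
    (g : T → T') : IsPiecewiseConstant fun x => g (r x) :=
  PiecewiseConstructible.mono h fun _ hS x hx y hy => congrArg g (hS x hx y hy)

theorem IsPiecewiseConstant.congr {T : Type*} {r r' : X → T} (h : IsPiecewiseConstant r)
    (h' : ∀ x, r x = r' x) : IsPiecewiseConstant r' :=
  funext h' ▸ h

theorem IsPiecewiseConstant.pi {m : ℕ} {T : Type*} {r : Fin m → X → T}
    (h : ∀ i, IsPiecewiseConstant (r i)) : IsPiecewiseConstant fun x i => r i x := by
  induction m with
  | zero => exact PiecewiseConstructible.of_univ fun x _ y _ => Subsingleton.elim _ _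
  | succ m ih =>
    have := ((h 0).prodMk (ih fun i => h i.succ)).comp fun t => (Fin.cons t.1 t.2 : Fin (m + 1) → T)
    refine PiecewiseConstructible.mono this fun S hS x hx y hy => ?_
    have key : ∀ x, (Fin.cons (r 0 x) fun i : Fin m => r i.succ x : Fin (m + 1) → T)
        = fun i => r i x := fun x => funext fun i => by
      cases i using Fin.cases <;> rfl
    exact (key x).symm.trans ((hS x hx y hy).trans (key y))

theorem IsPiecewiseConstant.isConstructible_preimage {T : Type*} {r : X → T}
    (h : IsPiecewiseConstant r) (B : Set T) : IsConstructible (r ⁻¹' B) := by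
  obtain ⟨𝒮, hf, hS, hU⟩ := h
  -- A piece that meets the preimage lies inside it.
  have : r ⁻¹' B = ⋃₀ {S ∈ 𝒮 | S ⊆ r ⁻¹' B} := by
    refine Set.Subset.antisymm (fun x hx => ?_) (Set.sUnion_subset fun S hS => hS.2)
    obtain ⟨S, hS', hxS⟩ := hU.symm ▸ Set.mem_univ x
    refine ⟨S, ⟨hS', fun y hy => ?_⟩, hxS⟩
    rw [Set.mem_preimage, (hS S hS').2 y hy x hxS]
    exact hx
  rw [this]
  exact IsConstructible.sUnion (hf.subset (Set.sep_subset _ _)) fun S hS' => (hS S hS'.1).1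

theorem IsPiecewiseConstant.of_isConstructible_le {r : X → ℕ} {b : ℕ} (hb : ∀ x, r x ≤ b)
    (h : ∀ n, IsConstructible {x | n ≤ r x}) : IsPiecewiseConstant r := by
  refine ⟨(fun n => {x | n ≤ r x} \ {x | n + 1 ≤ r x}) '' Set.Iic b,
    (Set.finite_Iic b).image _, ?_, Set.eq_univ_of_forall fun x => ?_⟩
  · rintro _ ⟨n, _, rfl⟩
    refine ⟨(h n).sdiff (h (n + 1)), fun x hx y hy => ?_⟩
    simp only [Set.mem_sdiff, Set.mem_ofPred_eq] at hx hy
    omega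
  · exact ⟨_, ⟨r x, hb x, rfl⟩, by simp⟩

end Piecewise

/-! ### Rings of functions that are stable under inversion -/

section ConstructibleRing

variable {X : Type*} [TopologicalSpace X] {K : Type*} [Field K]

/-- A ring of functions closed under (pointwise, total) inversion all of whose members have a
constructible zero set. -/
structure IsConstructibleRing (R : Subring (X → K)) : Prop where
  inv_mem : ∀ f ∈ R, f⁻¹ ∈ R
  isConstructible_zero : ∀ f ∈ R, IsConstructible {x | f x = 0}

/-- The convention `0⁻¹ = 0` makes `a * a⁻¹ * a = a` hold also where `a` vanishes. -/
theorem IsConstructibleRing.exists_mul_mul_eq_self {R : Subring (X → K)}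
    (hR : IsConstructibleRing R) (a : R) : ∃ b, a * b * a = a := by
  refine ⟨⟨_, hR.inv_mem a a.2⟩, Subtype.ext (funext fun x => ?_)⟩
  exact mul_inv_mul_cancel (a.1 x)

/-- The functions that are, piecewise on constructible sets, quotients of members of `P`. -/
def piecewiseFractions (P : Subring (X → K)) : Subring (X → K) where
  carrier := {f | PiecewiseConstructible fun S => ∃ g ∈ P, ∃ h ∈ P, ∀ x ∈ S,
    h x ≠ 0 ∧ f x = g x / h x}
  zero_mem' := .of_univ ⟨0, P.zero_mem, 1, P.one_mem, by simp⟩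
  one_mem' := .of_univ ⟨1, P.one_mem, 1, P.one_mem, by simp⟩
  add_mem' hf hf' := by
    refine PiecewiseConstructible.inter hf hf' ?_
    rintro S T ⟨g, hg, h, hh, H⟩ ⟨g', hg', h', hh', H'⟩
    refine ⟨g * h' + h * g', P.add_mem (P.mul_mem hg hh') (P.mul_mem hh hg'), h * h',
      P.mul_mem hh hh', fun x hx => ?_⟩
    obtain ⟨h1, h2⟩ := H x hx.1
    obtain ⟨h1', h2'⟩ := H' x hx.2
    exact ⟨mul_ne_zero h1 h1', by simp [h2, h2', div_add_div _ _ h1 h1']⟩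
  mul_mem' hf hf' := by
    refine PiecewiseConstructible.inter hf hf' ?_
    rintro S T ⟨g, hg, h, hh, H⟩ ⟨g', hg', h', hh', H'⟩
    refine ⟨g * g', P.mul_mem hg hg', h * h', P.mul_mem hh hh', fun x hx => ?_⟩
    obtain ⟨h1, h2⟩ := H x hx.1
    obtain ⟨h1', h2'⟩ := H' x hx.2
    exact ⟨mul_ne_zero h1 h1', by simp [h2, h2', div_mul_div_comm]⟩
  neg_mem' hf := by
    refine PiecewiseConstructible.mono hf ?_
    rintro S ⟨g, hg, h, hh, H⟩
    exact ⟨-g, P.neg_mem hg, h, hh, fun x hx => ⟨(H x hx).1, by simp [(H x hx).2, neg_div]⟩⟩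

theorem le_piecewiseFractions (P : Subring (X → K)) : P ≤ piecewiseFractions P :=
  fun f hf => .of_univ ⟨f, hf, 1, P.one_mem, by simp⟩

theorem isConstructibleRing_piecewiseFractions {P : Subring (X → K)}
    (hP : ∀ f ∈ P, IsConstructible {x | f x = 0}) :
    IsConstructibleRing (piecewiseFractions P) where
  isConstructible_zero f hf := by
    obtain ⟨𝒮, hfin, hS, hU⟩ := hf
    have : {x | f x = 0} = ⋃₀ ((fun S => S ∩ {x | f x = 0}) '' 𝒮) := by
      rw [Set.sUnion_image, ← Set.iUnion₂_inter, ← Set.sUnion_eq_biUnion, hU, Set.univ_inter]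
    rw [this]
    refine IsConstructible.sUnion (hfin.image _) ?_
    rintro _ ⟨S, hS', rfl⟩
    obtain ⟨hc, g, hg, h, hh, H⟩ := hS S hS'
    have : S ∩ {x | f x = 0} = S ∩ {x | g x = 0} := by
      ext x
      refine and_congr_right fun hx => ?_
      obtain ⟨h1, h2⟩ := H x hx
      simp [h2, h1]
    dsimp only
    rw [this]
    exact hc.inter (hP g hg)
  inv_mem f hf := by
    obtain ⟨𝒮, hfin, hS, hU⟩ := hf
    -- Where `f = g / h` on a piece, the inverse is `0 / 1` on the zero set of `f` and `h / g` off
    -- it.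
    refine ⟨⋃ S ∈ 𝒮, {S ∩ {x | f x = 0}, S ∩ {x | f x = 0}ᶜ}, ?_, ?_, ?_⟩
    · exact hfin.biUnion fun S _ => Set.toFinite _
    · intro T hT
      simp only [Set.mem_iUnion, exists_prop] at hT
      obtain ⟨S, hS', hT⟩ := hT
      obtain ⟨hc, g, hg, h, hh, H⟩ := hS S hS'
      have : S ∩ {x | f x = 0} = S ∩ {x | g x = 0} := by
        ext x
        refine and_congr_right fun hx => ?_
        obtain ⟨h1, h2⟩ := H x hx
        simp [h2, h1]
      have h' : S ∩ {x | f x = 0}ᶜ = S \ (S ∩ {x | f x = 0}) := by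
        rw [Set.sdiff_self_inter, Set.sdiff_eq]
      have hcz : IsConstructible (S ∩ {x | f x = 0}) := this ▸ hc.inter (hP g hg)
      rcases hT with rfl | rfl
      · exact ⟨hcz, 0, P.zero_mem, 1, P.one_mem, fun x hx => ⟨one_ne_zero, by
          have : f x = 0 := hx.2
          simp [this]⟩⟩
      · refine ⟨h' ▸ hc.sdiff hcz, h, hh, g, hg, fun x hx => ?_⟩
        obtain ⟨h1, h2⟩ := H x hx.1
        have h3 : f x ≠ 0 := hx.2
        exact ⟨fun h0 => h3 (by rw [h2, h0, zero_div]), by simp [h2]⟩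
    · refine Set.eq_univ_of_forall fun x => ?_
      obtain ⟨S, hS', hx⟩ := hU.symm ▸ Set.mem_univ x
      by_cases h0 : f x = 0
      · exact ⟨_, Set.mem_biUnion hS' (Or.inl rfl), hx, h0⟩
      · exact ⟨_, Set.mem_biUnion hS' (Or.inr rfl), hx, h0⟩

end ConstructibleRing

/-! ### The Zariski topology on the representation space -/

section RepSpace

variable {K : Type k} [Field K] {V : Type u} [Quiver.{v} V] {α : V → ℕ}

theorem RepSpace.isClosed_iff {Z : Set (RepSpace K α)} :
    IsClosed Z ↔ ∃ S : Set (MvPolynomial (RepCoord α) K),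
      Z = {φ | ∀ p ∈ S, MvPolynomial.eval φ.coord p = 0} := by
  rw [← isOpen_compl_iff]
  change Zᶜᶜ ∈ _ ↔ _
  rw [compl_compl]
  rfl

/-- The polynomials vanishing on a set. -/
def RepSpace.vanishingIdeal (Z : Set (RepSpace K α)) : Ideal (MvPolynomial (RepCoord α) K) where
  carrier := {p | ∀ φ ∈ Z, MvPolynomial.eval φ.coord p = 0}
  add_mem' hp hq φ hφ := by simp [hp φ hφ, hq φ hφ]
  zero_mem' φ _ := by simp
  smul_mem' c p hp φ hφ := by simp [hp φ hφ]

/-- A closed set is determined by its vanishing ideal, and by Hilbert's basis theorem ideals in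
finitely many variables satisfy the ascending chain condition. Consequently every open set is
compact, which removes the compactness conditions built into `IsConstructible`. -/
instance RepSpace.noetherianSpace [IsFiniteQuiver V] :
    TopologicalSpace.NoetherianSpace (RepSpace K α) := by
  refine ((TopologicalSpace.noetherianSpace_TFAE (RepSpace K α)).out 0 1).2 ?_
  let I : TopologicalSpace.Closeds (RepSpace K α) → (Ideal (MvPolynomial (RepCoord α) K))ᵒᵈ :=
    fun Z => OrderDual.toDual (RepSpace.vanishingIdeal (Z : Set (RepSpace K α)))
  have hle : ∀ Z W, I Z ≤ I W → Z ≤ W := by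
    intro Z W h φ hφ
    obtain ⟨S, hS⟩ := RepSpace.isClosed_iff.1 W.isClosed
    change φ ∈ (W : Set _)
    rw [hS]
    intro p hp
    have : p ∈ RepSpace.vanishingIdeal (W : Set (RepSpace K α)) := fun ψ hψ => by
      rw [hS] at hψ
      exact hψ p hp
    exact h this φ hφ
  have hmono : Monotone I := fun Z W h p hp φ hφ => hp φ (h hφ)
  exact (hmono.strictMono_of_injective fun Z W h =>
    le_antisymm (hle Z W h.le) (hle W Z h.ge)).wellFoundedLT

variable (K α) in
/-- The ring of polynomial functions. -/
noncomputable def RepSpace.polynomialFunctions : Subring (RepSpace K α → K) :=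
  (RingHom.pi fun φ : RepSpace K α => MvPolynomial.eval φ.coord).range

theorem RepSpace.isConstructible_zero [IsFiniteQuiver V] (f : RepSpace K α → K)
    (hf : f ∈ RepSpace.polynomialFunctions K α) : IsConstructible {φ | f φ = 0} := by
  obtain ⟨p, rfl⟩ := hf
  have hc : IsClosed {φ : RepSpace K α | MvPolynomial.eval φ.coord p = 0} :=
    RepSpace.isClosed_iff.2 ⟨{p}, by simp⟩
  rw [← isConstructible_compl]
  exact (TopologicalSpace.NoetherianSpace.isCompact _).isConstructible hc.isOpen_compl

end RepSpace

/-! ### Families of subspaces with coordinates in a ring of functions -/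

section DefinableSubspace

variable {X : Type*} {K : Type*} [Field K]

/-- Evaluation of the members of a ring of functions at a point. -/
def Subring.evalAt (R : Subring (X → K)) (p : X) : R →+* K :=
  (Pi.evalRingHom (fun _ => K) p).comp R.subtype

/-- The linear map given at a point by a matrix of functions. -/
def Matrix.linAt {R : Subring (X → K)} {ι κ : Type*} [Fintype κ] (M : Matrix ι κ R) (p : X) :
    (κ → K) →ₗ[K] (ι → K) :=
  (M.map (R.evalAt p)).mulVecLin

variable {R : Subring (X → K)} {ι κ μ : Type*} [Fintype κ]

theorem Matrix.linAt_apply (M : Matrix ι κ R) (p : X) (v : κ → K) (i : ι) :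
    M.linAt p v i = ∑ j, (M i j).1 p * v j :=
  rfl

theorem Matrix.linAt_mul [Fintype μ] (M : Matrix ι κ R) (N : Matrix κ μ R) (p : X) :
    (M * N).linAt p = M.linAt p ∘ₗ N.linAt p := by
  rw [Matrix.linAt, Matrix.map_mul, Matrix.mulVecLin_mul]
  rfl

theorem Matrix.linAt_one [Fintype ι] [DecidableEq ι] (p : X) :
    (1 : Matrix ι ι R).linAt p = LinearMap.id := by
  rw [Matrix.linAt, Matrix.map_one _ (map_zero _) (map_one _), Matrix.mulVecLin_one]

theorem Matrix.linAt_sub (M N : Matrix ι κ R) (p : X) :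
    (M - N).linAt p = M.linAt p - N.linAt p := by
  refine LinearMap.ext fun v => funext fun i => ?_
  simp [Matrix.linAt_apply, sub_mul, Finset.sum_sub_distrib]

/-- Choosing `r` independent columns turns a rank bound into finitely many injectivity conditions.
-/
theorem Matrix.le_finrank_range_linAt_iff [Fintype ι] (M : Matrix ι κ R) (p : X) (r : ℕ) :
    r ≤ Module.finrank K (LinearMap.range (M.linAt p)) ↔
      ∃ f : Fin r → κ, Function.Injective ((M.submatrix id f).linAt p) := by
  have hinj : ∀ f : Fin r → κ, Function.Injective ((M.submatrix id f).linAt p) ↔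
      LinearIndependent K fun i => (M.map (R.evalAt p)).col (f i) := fun f =>
    Matrix.mulVec_injective_iff
  simp only [hinj]
  rw [Matrix.linAt, Matrix.range_mulVecLin]
  constructor
  · intro h
    obtain ⟨g, hg, _, hli⟩ :=
      Submodule.exists_fun_fin_finrank_span_eq (K := K) (Set.range (M.map (R.evalAt p)).col)
    choose f hf using hg
    refine ⟨fun i => f (Fin.castLE h i), ?_⟩
    simp only [hf]
    exact hli.comp _ (Fin.castLE_injective h)
  · rintro ⟨f, hf⟩
    have := finrank_span_eq_card hf
    rw [Fintype.card_fin] at this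
    rw [← this]
    exact Submodule.finrank_mono (Submodule.span_mono (by rintro _ ⟨i, rfl⟩; exact ⟨_, rfl⟩))

variable [Fintype ι]

variable (R) in
/-- A family of subspaces that is the kernel of a matrix with entries in `R`. -/
def IsDefinableSubspace (U : X → Submodule K (ι → K)) : Prop :=
  ∃ M : Matrix ι ι R, ∀ p, U p = LinearMap.ker (M.linAt p)

theorem IsDefinableSubspace.bot : IsDefinableSubspace R fun _ => (⊥ : Submodule K (ι → K)) := by
  classical
  exact ⟨1, fun p => by rw [Matrix.linAt_one, LinearMap.ker_id]⟩

variable [TopologicalSpace X]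

/-- Since `M = M * G * M`, the square matrix `G * M` has the same kernel as `M`. -/
theorem IsDefinableSubspace.ker (hR : IsConstructibleRing R) (M : Matrix κ ι R) :
    IsDefinableSubspace R fun p => LinearMap.ker (M.linAt p) := by
  obtain ⟨G, hG⟩ := M.exists_mul_mul_eq_self hR.exists_mul_mul_eq_self
  refine ⟨G * M, fun p => le_antisymm ?_ ?_⟩
  · rw [Matrix.linAt_mul]
    exact LinearMap.ker_le_ker_comp _ _
  · dsimp only
    conv_rhs => rw [← hG, Matrix.mul_assoc, Matrix.linAt_mul]
    exact LinearMap.ker_le_ker_comp _ _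

/-- The matrix `M * G` is a projection onto the range of `M`, so that range is `ker (1 - M * G)`. -/
theorem IsDefinableSubspace.range (hR : IsConstructibleRing R) (M : Matrix ι κ R) :
    IsDefinableSubspace R fun p => LinearMap.range (M.linAt p) := by
  classical
  obtain ⟨G, hG⟩ := M.exists_mul_mul_eq_self hR.exists_mul_mul_eq_self
  refine ⟨1 - M * G, fun p => le_antisymm ?_ fun v hv => ?_⟩
  · rw [LinearMap.range_le_ker_iff, ← Matrix.linAt_mul, Matrix.sub_mul, hG, Matrix.one_mul,
      sub_self]
    exact LinearMap.ext fun v => funext fun i => by simp [Matrix.linAt_apply]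
  · rw [LinearMap.mem_ker, Matrix.linAt_sub, Matrix.linAt_one, Matrix.linAt_mul,
      LinearMap.sub_apply, sub_eq_zero] at hv
    exact ⟨G.linAt p v, hv.symm⟩

/-- The matrix `1 - G * M` is a projection onto the kernel of `M`. -/
theorem IsDefinableSubspace.exists_range (hR : IsConstructibleRing R) {U : X → Submodule K (ι → K)}
    (hU : IsDefinableSubspace R U) :
    ∃ N : Matrix ι ι R, ∀ p, U p = LinearMap.range (N.linAt p) := by
  classical
  obtain ⟨M, hM⟩ := hU
  obtain ⟨G, hG⟩ := M.exists_mul_mul_eq_self hR.exists_mul_mul_eq_self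
  refine ⟨1 - G * M, fun p => (hM p).trans (le_antisymm (fun v hv => ?_) ?_)⟩
  · refine ⟨v, ?_⟩
    rw [Matrix.linAt_sub, Matrix.linAt_one, Matrix.linAt_mul]
    simp [LinearMap.mem_ker.1 hv]
  · rw [LinearMap.range_le_ker_iff, ← Matrix.linAt_mul, Matrix.mul_sub, ← Matrix.mul_assoc, hG,
      Matrix.mul_one, sub_self]
    exact LinearMap.ext fun v => funext fun i => by simp [Matrix.linAt_apply]

theorem IsDefinableSubspace.top (hR : IsConstructibleRing R) :
    IsDefinableSubspace R fun _ => (⊤ : Submodule K (ι → K)) := by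
  classical
  obtain ⟨M, hM⟩ := IsDefinableSubspace.range hR (1 : Matrix ι ι R)
  exact ⟨M, fun p => by simpa only [Matrix.linAt_one, LinearMap.range_id] using hM p⟩

theorem IsDefinableSubspace.map (hR : IsConstructibleRing R)
    {U : X → Submodule K (κ → K)} (hU : IsDefinableSubspace R U)
    (A : Matrix ι κ R) : IsDefinableSubspace R fun p => (U p).map (A.linAt p) := by
  obtain ⟨N, hN⟩ := hU.exists_range hR
  obtain ⟨M, hM⟩ := IsDefinableSubspace.range hR (A * N)
  exact ⟨M, fun p => by simpa only [hN, Matrix.linAt_mul, LinearMap.range_comp] using hM p⟩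

theorem IsDefinableSubspace.comap (hR : IsConstructibleRing R)
    {U : X → Submodule K (κ → K)} (hU : IsDefinableSubspace R U)
    (A : Matrix κ ι R) : IsDefinableSubspace R fun p => (U p).comap (A.linAt p) := by
  obtain ⟨N, hN⟩ := hU
  obtain ⟨M, hM⟩ := IsDefinableSubspace.ker hR (N * A)
  exact ⟨M, fun p => by simpa only [hN, Matrix.linAt_mul, LinearMap.ker_comp] using hM p⟩

theorem IsDefinableSubspace.inf (hR : IsConstructibleRing R)
    {U W : X → Submodule K (ι → K)} (hU : IsDefinableSubspace R U)
    (hW : IsDefinableSubspace R W) : IsDefinableSubspace R fun p => U p ⊓ W p := by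
  obtain ⟨M, hM⟩ := hU
  obtain ⟨N, hN⟩ := hW
  obtain ⟨L, hL⟩ := IsDefinableSubspace.ker hR (Matrix.of (Sum.elim M N) : Matrix (ι ⊕ ι) ι R)
  refine ⟨L, fun p => Eq.trans ?_ (hL p)⟩
  dsimp only
  rw [hM, hN]
  ext v
  simp only [Submodule.mem_inf, LinearMap.mem_ker, funext_iff, Sum.forall]
  rfl

theorem IsDefinableSubspace.sup (hR : IsConstructibleRing R)
    {U W : X → Submodule K (ι → K)} (hU : IsDefinableSubspace R U)
    (hW : IsDefinableSubspace R W) : IsDefinableSubspace R fun p => U p ⊔ W p := by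
  obtain ⟨M, hM⟩ := hU.exists_range hR
  obtain ⟨N, hN⟩ := hW.exists_range hR
  obtain ⟨L, hL⟩ := IsDefinableSubspace.range hR
    (Matrix.of fun i => Sum.elim (M i) (N i) : Matrix ι (ι ⊕ ι) R)
  have key : ∀ p v, (Matrix.of fun i => Sum.elim (M i) (N i) : Matrix ι (ι ⊕ ι) R).linAt p v
      = M.linAt p (fun j => v (.inl j)) + N.linAt p fun j => v (.inr j) := by
    intro p v
    ext i
    simp [Matrix.linAt_apply]
  refine ⟨L, fun p => Eq.trans ?_ (hL p)⟩
  dsimp only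
  rw [hM, hN]
  refine le_antisymm (sup_le ?_ ?_) ?_
  · rintro _ ⟨v, rfl⟩
    exact ⟨Sum.elim v 0, by rw [key]; simp [← Pi.zero_def]⟩
  · rintro _ ⟨v, rfl⟩
    exact ⟨Sum.elim 0 v, by rw [key]; simp [← Pi.zero_def]⟩
  · rintro _ ⟨v, rfl⟩
    rw [key]
    exact Submodule.add_mem_sup ⟨_, rfl⟩ ⟨_, rfl⟩

theorem IsDefinableSubspace.iInf (hR : IsConstructibleRing R)
    {T : Type*} [Finite T] {U : T → X → Submodule K (ι → K)}
    (hU : ∀ t, IsDefinableSubspace R (U t)) : IsDefinableSubspace R fun p => ⨅ t, U t p := by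
  classical
  have := Fintype.ofFinite T
  suffices H : ∀ s : Finset T, IsDefinableSubspace R fun p => ⨅ t ∈ s, U t p by
    simpa using H Finset.univ
  intro s
  induction s using Finset.induction_on with
  | empty => simpa using IsDefinableSubspace.top hR
  | insert t s _ ih =>
    simp only [Finset.iInf_insert]
    exact (hU t).inf hR ih

theorem IsDefinableSubspace.iSup (hR : IsConstructibleRing R)
    {T : Type*} [Finite T] {U : T → X → Submodule K (ι → K)}
    (hU : ∀ t, IsDefinableSubspace R (U t)) : IsDefinableSubspace R fun p => ⨆ t, U t p := by
  classical
  have := Fintype.ofFinite T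
  suffices H : ∀ s : Finset T, IsDefinableSubspace R fun p => ⨆ t ∈ s, U t p by
    simpa using H Finset.univ
  intro s
  induction s using Finset.induction_on with
  | empty => simpa using IsDefinableSubspace.bot
  | insert t s _ ih =>
    simp only [Finset.iSup_insert]
    exact (hU t).sup hR ih

/-- As `M * (1 - G * M) = 0`, injectivity at a point means that `1 - G * M` vanishes there, which is
a finite list of equations in `R`. -/
theorem IsConstructibleRing.isConstructible_injective (hR : IsConstructibleRing R) (M : Matrix ι κ R) :
    IsConstructible {p | Function.Injective (M.linAt p)} := by
  classical
  obtain ⟨G, hG⟩ := M.exists_mul_mul_eq_self hR.exists_mul_mul_eq_self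
  have : {p | Function.Injective (M.linAt p)} =
      ⋂ i, ⋂ j, {p | ((1 - G * M : Matrix κ κ R) i j).1 p = 0} := by
    ext p
    simp only [Set.mem_iInter, Set.mem_ofPred_eq]
    constructor
    · intro h i j
      have h0 : (1 - G * M : Matrix κ κ R).linAt p (Pi.single j 1) = 0 := by
        apply h
        rw [map_zero, ← LinearMap.comp_apply, ← Matrix.linAt_mul, Matrix.mul_sub,
          ← Matrix.mul_assoc, hG, Matrix.mul_one, sub_self]
        exact funext fun i => by simp [Matrix.linAt_apply]
      simpa [Matrix.linAt_apply, Pi.single_apply] using congrFun h0 i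
    · intro h
      have h0 : (1 - G * M : Matrix κ κ R).linAt p = 0 :=
        LinearMap.ext fun v => funext fun i => by
          rw [Matrix.linAt_apply]
          exact Finset.sum_eq_zero fun j _ => by rw [h i j, zero_mul]
      rw [Matrix.linAt_sub, Matrix.linAt_one, Matrix.linAt_mul, sub_eq_zero] at h0
      exact Function.LeftInverse.injective (g := G.linAt p) fun v =>
        (LinearMap.congr_fun h0 v).symm
  rw [this]
  exact .iInter fun i => .iInter fun j => hR.isConstructible_zero _ (Subtype.property _)

theorem IsDefinableSubspace.isPiecewiseConstant_finrank (hR : IsConstructibleRing R)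
    {U : X → Submodule K (ι → K)}
    (hU : IsDefinableSubspace R U) : IsPiecewiseConstant fun p => Module.finrank K (U p) := by
  obtain ⟨N, hN⟩ := hU.exists_range hR
  refine .of_isConstructible_le (b := Fintype.card ι) (fun p => ?_) fun n => ?_
  · exact (Submodule.finrank_le _).trans_eq (Module.finrank_fintype_fun_eq_card K)
  · have : {p | n ≤ Module.finrank K (U p)} =
        ⋃ f : Fin n → ι, {p | Function.Injective ((N.submatrix id f).linAt p)} := by
      ext p
      simp only [Set.mem_iUnion, Set.mem_ofPred_eq]
      rw [hN, Matrix.le_finrank_range_linAt_iff]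
    rw [this]
    exact .iUnion fun f => hR.isConstructible_injective _

end DefinableSubspace

/-! ### Computing the largest epimorphic subrepresentation and the largest monomorphic quotient -/

/-- A measure bounded by `b` cannot increase strictly `b + 1` times, so two consecutive terms agree
at some index at most `b`; from there on the iteration is constant. -/
theorem Nat.eq_succ_of_iterate_of_bounded {T : Type*} {u : ℕ → T} {F : T → T}
    (hu : ∀ n, u (n + 1) = F (u n)) {D : T → ℕ} {b : ℕ} (hb : ∀ n, D (u n) ≤ b)
    (hmono : ∀ n, D (u n) ≤ D (u (n + 1))) (h : ∀ n, D (u n) = D (u (n + 1)) → u n = u (n + 1)) :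
    u b = u (b + 1) := by
  obtain ⟨m, hm, hDm⟩ : ∃ m ≤ b, D (u m) = D (u (m + 1)) := by
    by_contra! H
    have : ∀ m ≤ b + 1, m ≤ D (u m) := by
      intro m
      induction m with
      | zero => simp
      | succ m ih =>
        intro hm
        have := H m (by omega)
        have := hmono m
        have := ih (by omega)
        omega
    have := this (b + 1) le_rfl
    have := hb (b + 1)
    omega
  have hk : ∀ k, u (m + k) = u (m + k + 1) := by
    intro k
    induction k with
    | zero => exact h m hDm
    | succ k ih => exact (hu _).trans ((congrArg F ih).trans (hu _).symm)
  obtain ⟨k, rfl⟩ := Nat.exists_eq_add_of_le hm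
  exact hk k

namespace QuiverRep

variable {K : Type k} [Field K] {V : Type u} [Quiver.{v} V]

/-- Successive approximations of `surjRep` from above. -/
def surjIter (φ : QuiverRep.{u, v, k, w} K V) : ℕ → ∀ x, Submodule K (φ.space x)
  | 0, _ => ⊤
  | n + 1, x => φ.surjIter n x ⊓ ((⨅ a : Σ y, y ⟶ x, (φ.surjIter n a.1).map (φ.map a.2)) ⊓
      ⨅ a : Σ y, x ⟶ y, (φ.surjIter n a.1).comap (φ.map a.2))

/-- Successive approximations of `injKer` from below. -/
def injIter (φ : QuiverRep.{u, v, k, w} K V) : ℕ → ∀ x, Submodule K (φ.space x)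
  | 0, _ => ⊥
  | n + 1, x => φ.injIter n x ⊔ ((⨆ a : Σ y, y ⟶ x, (φ.injIter n a.1).map (φ.map a.2)) ⊔
      ⨆ a : Σ y, x ⟶ y, (φ.injIter n a.1).comap (φ.map a.2))

theorem surjRep_le_surjIter (φ : QuiverRep.{u, v, k, w} K V) (n : ℕ) (x : V) :
    φ.surjRep.carrier x ≤ φ.surjIter n x := by
  induction n generalizing x with
  | zero => exact le_top
  | succ n ih =>
    refine le_inf (ih x) (le_inf (le_iInf fun a z hz => ?_) (le_iInf fun a => ?_))
    · obtain ⟨t, ht⟩ := φ.surjRep_isEpimorphic _ _ a.2 ⟨z, hz⟩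
      exact ⟨t.1, ih _ t.2, congrArg Subtype.val ht⟩
    · exact (φ.surjRep.stable a.2).trans (Submodule.comap_mono (ih _))

theorem injIter_le_injKer (φ : QuiverRep.{u, v, k, w} K V) (n : ℕ) (x : V) :
    φ.injIter n x ≤ φ.injKer.carrier x := by
  induction n generalizing x with
  | zero => exact bot_le
  | succ n ih =>
    refine sup_le (ih x) (sup_le (iSup_le fun a => ?_) (iSup_le fun a z hz => ?_))
    · exact (Submodule.map_mono (ih _)).trans (Submodule.map_le_iff_le_comap.2
        (φ.injKer.stable a.2))
    · refine (Submodule.Quotient.mk_eq_zero _).1 (φ.injKer_isMonomorphic _ _ a.2 (a₂ := 0) ?_)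
      rw [map_zero]
      exact (Submodule.Quotient.mk_eq_zero _).2 (ih _ hz)

section Finite

variable [Fintype V]

theorem surjIter_eq_succ (φ : QuiverRep.{u, v, k, w} K V) {b : ℕ}
    (hb : ∑ x, Module.finrank K (φ.space x) ≤ b) : φ.surjIter b = φ.surjIter (b + 1) := by
  have hle : ∀ n x, φ.surjIter (n + 1) x ≤ φ.surjIter n x := fun n x => inf_le_left
  have hterm : ∀ n x, Module.finrank K (φ.space x) - Module.finrank K (φ.surjIter n x) ≤
      Module.finrank K (φ.space x) - Module.finrank K (φ.surjIter (n + 1) x) := fun n x =>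
    Nat.sub_le_sub_left (Submodule.finrank_mono (hle n x)) _
  refine Nat.eq_succ_of_iterate_of_bounded (u := φ.surjIter)
    (F := fun U x => U x ⊓ ((⨅ a : Σ y, y ⟶ x, (U a.1).map (φ.map a.2)) ⊓
      ⨅ a : Σ y, x ⟶ y, (U a.1).comap (φ.map a.2))) (fun n => rfl)
    -- The approximations decrease, so the increasing measure is the total codimension.
    (D := fun U => ∑ x, (Module.finrank K (φ.space x) - Module.finrank K (U x)))
    (fun n => (Finset.sum_le_sum fun x _ => Nat.sub_le _ _).trans hb)
    (fun n => Finset.sum_le_sum fun x _ => hterm n x) fun n h => ?_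
  funext x
  have := (Finset.sum_eq_sum_iff_of_le fun x _ => hterm n x).1 h x (Finset.mem_univ x)
  refine (Submodule.eq_of_le_of_finrank_eq (hle n x) ?_).symm
  have h1 := Submodule.finrank_le (φ.surjIter n x)
  have h2 := Submodule.finrank_le (φ.surjIter (n + 1) x)
  omega

theorem injIter_eq_succ (φ : QuiverRep.{u, v, k, w} K V) {b : ℕ}
    (hb : ∑ x, Module.finrank K (φ.space x) ≤ b) : φ.injIter b = φ.injIter (b + 1) := by
  have hle : ∀ n x, φ.injIter n x ≤ φ.injIter (n + 1) x := fun n x => le_sup_left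
  refine Nat.eq_succ_of_iterate_of_bounded (u := φ.injIter)
    (F := fun U x => U x ⊔ ((⨆ a : Σ y, y ⟶ x, (U a.1).map (φ.map a.2)) ⊔
      ⨆ a : Σ y, x ⟶ y, (U a.1).comap (φ.map a.2))) (fun n => rfl)
    (D := fun U => ∑ x, Module.finrank K (U x))
    (fun n => (Finset.sum_le_sum fun x _ => Submodule.finrank_le _).trans hb)
    (fun n => Finset.sum_le_sum fun x _ => Submodule.finrank_mono (hle n x)) fun n h => ?_
  funext x
  exact Submodule.eq_of_le_of_finrank_eq (hle n x)
    ((Finset.sum_eq_sum_iff_of_le fun x _ => Submodule.finrank_mono (hle n x)).1 h x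
      (Finset.mem_univ x))

/-- At a fixed point of the iteration the preimage terms say that the subspaces are stable, and the
image terms that every arrow is onto. Any upper bound `b` is allowed, so one `b` can serve a whole
family. -/
theorem surjRep_carrier_eq (φ : QuiverRep.{u, v, k, w} K V) {b : ℕ}
    (hb : ∑ x, Module.finrank K (φ.space x) ≤ b) (x : V) :
    φ.surjRep.carrier x = φ.surjIter b x := by
  have hfix : ∀ x, φ.surjIter b x ≤ _ := fun x => (congrFun (φ.surjIter_eq_succ hb) x).le
  refine le_antisymm (φ.surjRep_le_surjIter b x) ?_
  refine φ.le_surjRep ⟨φ.surjIter b, fun {x y} a => ?_⟩ ?_ x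
  · exact (hfix x).trans (inf_le_right.trans (inf_le_right.trans
      (iInf_le (fun a : Σ y, x ⟶ y => (φ.surjIter b a.1).comap (φ.map a.2)) ⟨y, a⟩)))
  · rintro x y a ⟨z, hz⟩
    have : φ.surjIter b y ≤ (φ.surjIter b x).map (φ.map a) :=
      (hfix y).trans (inf_le_right.trans (inf_le_left.trans
        (iInf_le (fun a : Σ x, x ⟶ y => (φ.surjIter b a.1).map (φ.map a.2)) ⟨x, a⟩)))
    obtain ⟨t, ht, h⟩ := this hz
    exact ⟨⟨t, ht⟩, Subtype.ext h⟩

/-- Dually, at a fixed point the image terms give stability and the preimage terms give injectivity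
on the quotient. -/
theorem injKer_carrier_eq (φ : QuiverRep.{u, v, k, w} K V) {b : ℕ}
    (hb : ∑ x, Module.finrank K (φ.space x) ≤ b) (x : V) :
    φ.injKer.carrier x = φ.injIter b x := by
  have hfix : ∀ x, _ ≤ φ.injIter b x := fun x => (congrFun (φ.injIter_eq_succ hb) x).ge
  refine le_antisymm ?_ (φ.injIter_le_injKer b x)
  refine φ.injKer_le ⟨φ.injIter b, fun {x y} a => ?_⟩ ?_ x
  · refine Submodule.map_le_iff_le_comap.1 (le_trans ?_ (hfix y))
    exact (le_iSup (fun a : Σ x, x ⟶ y => (φ.injIter b a.1).map (φ.map a.2)) ⟨x, a⟩).trans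
      (le_sup_left.trans le_sup_right)
  · intro x y a
    refine (injective_iff_map_eq_zero _).2 fun z => ?_
    obtain ⟨t, rfl⟩ := Submodule.Quotient.mk_surjective _ z
    intro h
    have h1 : t ∈ (φ.injIter b y).comap (φ.map a) :=
      (Submodule.Quotient.mk_eq_zero (φ.injIter b y)).1 h
    have h2 : (φ.injIter b y).comap (φ.map a) ≤ φ.injIter b x :=
      ((le_iSup (fun a : Σ y, x ⟶ y => (φ.injIter b a.1).comap (φ.map a.2)) ⟨y, a⟩).trans
        (le_sup_right.trans le_sup_right)).trans (hfix x)
    exact (Submodule.Quotient.mk_eq_zero _).2 (h2 h1)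

end Finite

/-- Rank–nullity for the map from `surjRep` to the quotient by `injKer`. -/
theorem finrank_rk_add (φ : QuiverRep.{u, v, k, w} K V) (x : V) :
    Module.finrank K (φ.rk.carrier x) +
      Module.finrank K (φ.surjRep.carrier x ⊓ φ.injKer.carrier x : Submodule K (φ.space x)) =
      Module.finrank K (φ.surjRep.carrier x) := by
  rw [← LinearMap.finrank_range_add_finrank_ker
    ((φ.injKer.carrier x).mkQ ∘ₗ (φ.surjRep.carrier x).subtype)]
  rw [LinearMap.ker_comp, Submodule.ker_mkQ, ← Submodule.map_comap_subtype,
    Submodule.finrank_map_subtype_eq]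
  rfl

open Classical in
theorem pushforward_map_apply {W : Type u} [Quiver.{v} W] [IsFiniteQuiver V] (f : V ⥤q W)
    (φ : QuiverRep.{u, v, k, w} K V) {x y : W} [Fintype {z : V // f.obj z = x}]
    [∀ (z : {z : V // f.obj z = x}) (z' : {z : V // f.obj z = y}) (a : x ⟶ y),
      Fintype {b : z.1 ⟶ z'.1 // Quiver.homOfEq (f.map b) z.2 z'.2 = a}] (a : x ⟶ y)
    (t : ∀ z : {z : V // f.obj z = x}, φ.space z.1) (z' : {z : V // f.obj z = y}) :
    (show ∀ z : {z : V // f.obj z = y}, φ.space z.1 from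
      (QuiverRep.pushforward.{u, v, k, w} f φ).map a t) z' =
      ∑ z : {z : V // f.obj z = x},
        ∑ b : {b : z.1 ⟶ z'.1 // Quiver.homOfEq (f.map b) z.2 z'.2 = a}, φ.map b.1 (t z) := by
  change (∑ᶠ z : {z : V // f.obj z = x},
      ∑ᶠ b : {b : z.1 ⟶ z'.1 // Quiver.homOfEq (f.map b) z.2 z'.2 = a},
        φ.map b.1 ∘ₗ LinearMap.proj z) t = _
  simp [finsum_eq_sum_of_fintype, LinearMap.sum_apply]

/-! ### Families of representations -/

section Family

variable {X : Type*} {R : Subring (X → K)}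

variable (R) in
/-- A family of representations that, in suitable coordinates, is given by matrices with entries
in `R`. -/
def IsDefinableFamily (Φ : X → QuiverRep.{u, v, k, w} K V) : Prop :=
  ∃ (ι : V → Type u) (_ : ∀ x, Fintype (ι x)) (e : ∀ p x, (Φ p).space x ≃ₗ[K] (ι x → K)),
    ∀ (x y : V) (a : x ⟶ y), ∃ A : Matrix (ι y) (ι x) R,
      ∀ p t, e p y ((Φ p).map a t) = A.linAt p (e p x t)

variable {Φ : X → QuiverRep.{u, v, k, w} K V} {ι : V → Type*} [∀ x, Fintype (ι x)]
  {e : ∀ p x, (Φ p).space x ≃ₗ[K] (ι x → K)}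

theorem orderIsoMapComap_map {x y : V} {a : x ⟶ y} {A : Matrix (ι y) (ι x) R} {p : X}
    (h : ∀ t, e p y ((Φ p).map a t) = A.linAt p (e p x t)) (U : Submodule K ((Φ p).space x)) :
    Submodule.orderIsoMapComap (e p y) (U.map ((Φ p).map a)) =
      (Submodule.orderIsoMapComap (e p x) U).map (A.linAt p) := by
  change (U.map _).map (e p y).toLinearMap = (U.map (e p x).toLinearMap).map _
  rw [← Submodule.map_comp, ← Submodule.map_comp]
  exact congrArg (Submodule.map · U) (LinearMap.ext h)

theorem orderIsoMapComap_comap {x y : V} {a : x ⟶ y} {A : Matrix (ι y) (ι x) R} {p : X}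
    (h : ∀ t, e p y ((Φ p).map a t) = A.linAt p (e p x t)) (U : Submodule K ((Φ p).space y)) :
    Submodule.orderIsoMapComap (e p x) (U.comap ((Φ p).map a)) =
      (Submodule.orderIsoMapComap (e p y) U).comap (A.linAt p) := by
  ext t
  obtain ⟨t, rfl⟩ := (e p x).surjective t
  simp [Submodule.orderIsoMapComap, ← h]

theorem IsDefinableFamily.pullback {W : Type u} [Quiver.{v} W] (f : W ⥤q V)
    (hΦ : IsDefinableFamily R Φ) : IsDefinableFamily R fun p => (Φ p).pullback f := by
  obtain ⟨ι, _, e, hA⟩ := hΦ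
  exact ⟨fun x => ι (f.obj x), fun _ => inferInstance, fun p x => e p (f.obj x),
    fun x y a => hA _ _ (f.map a)⟩

variable [IsFiniteQuiver V]

theorem IsDefinableFamily.pushforward {W : Type u} [Quiver.{v} W] (f : V ⥤q W)
    (hΦ : IsDefinableFamily R Φ) :
    IsDefinableFamily R fun p => QuiverRep.pushforward.{u, v, k, w} f (Φ p) := by
  classical
  obtain ⟨ι, _, e, hA⟩ := hΦ
  choose A hA using hA
  have := fun x : W => Fintype.ofFinite {z : V // f.obj z = x}
  refine ⟨fun x => Σ z : {z : V // f.obj z = x}, ι z.1, fun x => inferInstance, fun p x =>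
    (LinearEquiv.piCongrRight fun z : {z : V // f.obj z = x} => e p z.1) ≪≫ₗ
      (LinearEquiv.piCurry K fun (z : {z : V // f.obj z = x}) (_ : ι z.1) => K).symm,
    fun x y a => ?_⟩
  have := fun (z : {z : V // f.obj z = x}) (z' : {z : V // f.obj z = y}) (a : x ⟶ y) =>
    Fintype.ofFinite {b : z.1 ⟶ z'.1 // Quiver.homOfEq (f.map b) z.2 z'.2 = a}
  -- A block matrix: the block from `z` to `z'` is the sum of the matrices of the arrows `z ⟶ z'`
  -- over `a`.
  refine ⟨Matrix.of fun i j =>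
    ∑ b : {b : j.1.1 ⟶ i.1.1 // Quiver.homOfEq (f.map b) j.1.2 i.1.2 = a},
      A _ _ b.1 i.2 j.2, fun p t => funext fun ⟨z', i⟩ => ?_⟩
  refine (congrArg (fun t => e p z'.1 t i) (pushforward_map_apply f (Φ p) a t z')).trans ?_
  rw [Matrix.linAt_apply, Fintype.sum_sigma, map_sum, Finset.sum_apply]
  refine Finset.sum_congr rfl fun z _ => ?_
  simp only [map_sum, Finset.sum_apply, hA, Matrix.linAt_apply]
  rw [Finset.sum_comm]
  refine Finset.sum_congr rfl fun j _ => ?_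
  simp only [Matrix.of_apply, AddSubmonoidClass.coe_finsetSum, Finset.sum_apply, Finset.sum_mul]
  rfl

variable [TopologicalSpace X]

/-- The coordinate isomorphisms induce lattice isomorphisms that carry images and preimages along
arrows to those along matrices over `R`, so the recursion can be run in coordinates. -/
theorem isDefinableSubspace_surjIter (hR : IsConstructibleRing R)
    (hA : ∀ (x y : V) (a : x ⟶ y), ∃ A : Matrix (ι y) (ι x) R,
      ∀ p t, e p y ((Φ p).map a t) = A.linAt p (e p x t)) (n : ℕ) (x : V) :
    IsDefinableSubspace R fun p =>
      Submodule.orderIsoMapComap (e p x) ((Φ p).surjIter n x) := by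
  choose A hA using hA
  induction n generalizing x with
  | zero => simpa [surjIter] using IsDefinableSubspace.top hR
  | succ n ih =>
    simp only [surjIter, map_inf, OrderIso.map_iInf]
    refine (ih x).inf hR (.inf hR (.iInf hR fun a => ?_) (.iInf hR fun a => ?_))
    · simp only [orderIsoMapComap_map (hA _ _ a.2 _)]
      exact (ih a.1).map hR _
    · simp only [orderIsoMapComap_comap (hA _ _ a.2 _)]
      exact (ih a.1).comap hR _

theorem isDefinableSubspace_injIter (hR : IsConstructibleRing R)
    (hA : ∀ (x y : V) (a : x ⟶ y), ∃ A : Matrix (ι y) (ι x) R,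
      ∀ p t, e p y ((Φ p).map a t) = A.linAt p (e p x t)) (n : ℕ) (x : V) :
    IsDefinableSubspace R fun p =>
      Submodule.orderIsoMapComap (e p x) ((Φ p).injIter n x) := by
  choose A hA using hA
  induction n generalizing x with
  | zero => simpa [injIter] using IsDefinableSubspace.bot
  | succ n ih =>
    simp only [injIter, map_sup, OrderIso.map_iSup]
    refine (ih x).sup hR (.sup hR (.iSup hR fun a => ?_) (.iSup hR fun a => ?_))
    · simp only [orderIsoMapComap_map (hA _ _ a.2 _)]
      exact (ih a.1).map hR _
    · simp only [orderIsoMapComap_comap (hA _ _ a.2 _)]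
      exact (ih a.1).comap hR _

theorem IsDefinableFamily.isPiecewiseConstant_globalRank [IsConnectedQuiver V]
    (hR : IsConstructibleRing R) (hΦ : IsDefinableFamily R Φ) :
    IsPiecewiseConstant fun p => (Φ p).globalRank := by
  have := Fintype.ofFinite V
  obtain ⟨ι, _, e, hA⟩ := hΦ
  -- The coordinate index sets do not depend on the point, so this number of iterations works for
  -- the whole family.
  set b := ∑ x, Fintype.card (ι x)
  have hb : ∀ p, ∑ x, Module.finrank K ((Φ p).space x) ≤ b := fun p =>
    Finset.sum_le_sum fun x _ => by
      rw [(e p x).finrank_eq, Module.finrank_fintype_fun_eq_card]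
  set x := Classical.choice (IsConnectedQuiver.nonempty (V := V)) with hx
  have hU := isDefinableSubspace_surjIter hR hA b x
  have hN := isDefinableSubspace_injIter hR hA b x
  have hfin : ∀ p (W : Submodule K ((Φ p).space x)),
      Module.finrank K (Submodule.orderIsoMapComap (e p x) W) = Module.finrank K W :=
    fun p W => LinearEquiv.finrank_map_eq (e p x) W
  refine (((hU.isPiecewiseConstant_finrank hR).prodMk
    ((hU.inf hR hN).isPiecewiseConstant_finrank hR)).comp fun t => t.1 - t.2).congr fun p => ?_
  have := (Φ p).finrank_rk_add x
  rw [surjRep_carrier_eq _ (hb p), injKer_carrier_eq _ (hb p)] at this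
  dsimp only
  rw [← map_inf, hfin, hfin]
  exact Nat.sub_eq_of_eq_add this.symm

end Family

end QuiverRep

/-! ### Rank functions along chains, and rank loci -/

section Main

theorem RankChain.isPiecewiseConstant_rank {X : Type*} [TopologicalSpace X] {K : Type k} [Field K]
    {R : Subring (X → K)} (hR : IsConstructibleRing R) {V : Type u} [Quiver.{v} V]
    (c : RankChain.{u, v} V) (Φ : X → QuiverRep.{u, v, k, max u w} K V)
    (hΦ : QuiverRep.IsDefinableFamily R Φ) :
    IsPiecewiseConstant fun p => RankChain.rank.{u, v, k, w} c (Φ p) := by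
  -- The parameter space and `R` stay fixed; only the quiver and the family over it change along the
  -- chain.
  induction c with
  | nil => exact hΦ.isPiecewiseConstant_globalRank hR
  | push f c ih => exact ih _ (hΦ.pushforward f)
  | pull f c ih => exact ih _ (hΦ.pullback f)

theorem RepSpace.isDefinableFamily_toRep {K : Type k} [Field K] {V : Type u} [Quiver.{v} V]
    {α : V → ℕ} {R : Subring (RepSpace K α → K)} (hR : polynomialFunctions K α ≤ R) :
    QuiverRep.IsDefinableFamily R fun φ : RepSpace K α => φ.toRep := by
  refine ⟨fun x => ULift.{u} (Fin (α x)), fun x => inferInstance, fun _ x =>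
    ULift.moduleEquiv ≪≫ₗ LinearEquiv.funCongrLeft K K Equiv.ulift, fun x y a => ?_⟩
  refine ⟨Matrix.of fun i j => ⟨fun φ => φ.coord ⟨x, y, a, i.down, j.down⟩,
    hR ⟨MvPolynomial.X ⟨x, y, a, i.down, j.down⟩, funext fun φ => by simp⟩⟩,
    fun φ t => funext fun i => ?_⟩
  rw [Matrix.linAt_apply]
  change φ x y a t.down i.down = ∑ j : ULift (Fin (α x)),
    φ x y a (Pi.single j.down 1) i.down * t.down j.down
  conv_lhs => rw [LinearMap.pi_apply_eq_sum_univ (φ x y a) t.down]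
  rw [Finset.sum_apply, ← Equiv.ulift.sum_comp]
  refine Finset.sum_congr rfl fun j _ => ?_
  rw [Pi.smul_apply, smul_eq_mul, mul_comm]
  have : (Pi.single j.down 1 : Fin (α x) → K) = fun l => if j.down = l then 1 else 0 :=
    funext fun l => by simp [Pi.single_apply, eq_comm]
  rw [this]
  rfl

end Main

/-- Over any field, the level sets of the global rank function of a finite connected quiver, and
all rank loci, are constructible in the representation space with its Zariski topology. -/
theorem theorem3p3 (K : Type k) [Field K] (V : Type u) [Quiver.{v} V] [IsFiniteQuiver V]
    [IsConnectedQuiver V] (α : V → ℕ) :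
    (∀ n : ℕ, Topology.IsConstructible {φ : RepSpace K α | φ.toRep.globalRank = n}) ∧
    (∀ L : Set (RepSpace K α), IsRankLocus L → Topology.IsConstructible L) := by
  have hR := isConstructibleRing_piecewiseFractions
    (RepSpace.isConstructible_zero (K := K) (V := V) (α := α))
  have hΦ := RepSpace.isDefinableFamily_toRep (le_piecewiseFractions
    (RepSpace.polynomialFunctions K α))
  refine ⟨fun n => (hΦ.isPiecewiseConstant_globalRank hR).isConstructible_preimage {n}, ?_⟩
  rintro _ ⟨m, l, c, A, b, strict, rfl⟩
  -- The inequalities enter only through the set of tuples in `ℕ^m` that they allow.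
  exact (IsPiecewiseConstant.pi fun i => (c i).isPiecewiseConstant_rank.{u, v, k, k} hR _
    hΦ).isConstructible_preimage {t : Fin m → ℕ | ∀ j : Fin l,
      ∑ i, A j i * (t i : ℝ) ≤ b j ∧ (j ∈ strict → ∑ i, A j i * (t i : ℝ) < b j)}
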